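/- For a set $V\subset\mathbb{C}^n$, let $\mathbb{R}[V]=\mathbb{R}[x_1,\dots,x_n]/\{f : f|_V=0\}$. Let $W\subset\mathbb{C}^n$ be an irreducible (complex affine, in particular nonempty) variety, let $V=W\cup\overline{W}$, where the bar is coordinatewise complex conjugation, let $L\subset\mathbb{R}[V]$ be a finite-dimensional real linear subspace of dimension $D$, and let $S\ge 0$ be an integer. For a tuple $Z=(z_1,\dots,z_S)$ of points of $W$, say that $(L,Z)$ is poised if the only $f\in L$ with $f(z_s)=0$ for all $s$ is $f=0$. If the entries of $v\in\mathbb{R}[V]^N$ span $L$, let $U$ be the complex $N\times S$ matrix with columns $v(z_1),\dots,v(z_S)$; the empirical dimension $D_e$ of $L$ with respect to $Z$ is the complex rank of $[\,U\mid\overline{U}\,]$ (it does not depend on the choice of $v$). Then the following holds for c-generic $Z$: if $D_e<2S$, then $(L,Z)$ is poised and $D=D_e$. That is, there is a polynomial $q$ with complex coefficients in $2Sn$ variables (depending only on $W$, $L$ and $S$) such that $q(z_1,\dots,z_S,\overline{z_1},\dots,\overline{z_S})$ is not identically zero for $z_1,\dots,z_S\in W$, and such that for every $Z\in W^S$ with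 $q(z_1,\dots,z_S,\overline{z_1},\dots,\overline{z_S})\neq 0$ and every generating vector $v$ of $L$, $D_e<2S$ implies that $(L,Z)$ is poised and $D=D_e$. -/

import Mathlib

noncomputable section

namespace CGeneric

open MvPolynomial

variable {n : ℕ}

/-- A (complex, affine) algebraic variety in `ℂⁿ`: the common zero set of some complex
polynomials. -/
def IsVariety (W : Set (Fin n → ℂ)) : Prop :=
  ∃ I : Ideal (MvPolynomial (Fin n) ℂ), W = zeroLocus ℂ I

/-- An irreducible variety: a nonempty variety that is not the union of two proper
subvarieties. -/
structure IsIrreducibleVariety (W : Set (Fin n → ℂ)) : Prop where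
  isVariety : IsVariety W
  nonempty : W.Nonempty
  eq_or_eq : ∀ A B : Set (Fin n → ℂ), IsVariety A → IsVariety B → W = A ∪ B → W = A ∨ W = B

/-- The complex conjugate of a set of points of `ℂⁿ` (coordinatewise conjugation). -/
def conjSet (W : Set (Fin n → ℂ)) : Set (Fin n → ℂ) := star '' W

/-- The self-conjugate set `V = W ∪ conj W`. -/
def selfConj (W : Set (Fin n → ℂ)) : Set (Fin n → ℂ) := W ∪ conjSet W

/-- The real coordinate ring `ℝ[V] = ℝ[x] / I_ℝ(V)`. -/
abbrev CoordRing (V : Set (Fin n → ℂ)) : Type :=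
  MvPolynomial (Fin n) ℝ ⧸ (vanishingIdeal ℝ V : Ideal (MvPolynomial (Fin n) ℝ))

/-- Evaluation of an element of `ℝ[V]` at a point `z` of `V`. -/
def evalAt (V : Set (Fin n → ℂ)) (z : V) : CoordRing V →ₐ[ℝ] ℂ :=
  Ideal.Quotient.liftₐ (vanishingIdeal ℝ V) (aeval (z : Fin n → ℂ)) (fun _ hp => hp z z.2)

/-- A point of `W`, seen as a point of `W ∪ conj W`. -/
def toSelfConj {W : Set (Fin n → ℂ)} (z : W) : selfConj W := ⟨z, Or.inl z.2⟩

/-- `(L, Z)` is poised: the only element of `L` that vanishes at all samples is zero. -/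
def Poised {V : Set (Fin n → ℂ)} {S : ℕ} (L : Submodule ℝ (CoordRing V)) (Z : Fin S → V) : Prop :=
  ∀ f ∈ L, (∀ s, evalAt V (Z s) f = 0) → f = 0

/-- The evaluation matrix `U`, with columns `v(z)`, `z ∈ Z`. -/
def evalMatrix {V : Set (Fin n → ℂ)} {S N : ℕ} (v : Fin N → CoordRing V) (Z : Fin S → V) :
    Matrix (Fin N) (Fin S) ℂ :=
  Matrix.of fun i s => evalAt V (Z s) (v i)

/-- The empirical dimension, with respect to the samples `Z`, of the space spanned by the entries
of `v`: the complex rank of the matrix `[U | conj U]`. -/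
def empiricalDim {V : Set (Fin n → ℂ)} {S N : ℕ} (v : Fin N → CoordRing V) (Z : Fin S → V) : ℕ :=
  (Matrix.fromCols (evalMatrix v Z) ((evalMatrix v Z).map star)).rank

/-- The value `q(z₁, …, z_S, conj z₁, …, conj z_S)`. The variable `Sum.inl (s, i)` stands for the
`i`-th coordinate of `z_s` and `Sum.inr (s, i)` for that of `conj z_s`. -/
def conjEval {S : ℕ} (q : MvPolynomial ((Fin S × Fin n) ⊕ (Fin S × Fin n)) ℂ)
    (Z : Fin S → Fin n → ℂ) : ℂ :=
  eval (Sum.elim (fun p => Z p.1 p.2) (fun p => star (Z p.1 p.2))) q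

/-- A property of `S`-tuples of points of `W` holds c-generically: there is a polynomial in the
samples and their conjugates, not identically zero on tuples from `W`, such that the property
holds for every tuple at which this polynomial does not vanish. -/
def HoldsCGenerically (W : Set (Fin n → ℂ)) (S : ℕ) (P : (Fin S → W) → Prop) : Prop :=
  ∃ q : MvPolynomial ((Fin S × Fin n) ⊕ (Fin S × Fin n)) ℂ,
    (∃ Z : Fin S → W, conjEval q (fun s => (Z s : Fin n → ℂ)) ≠ 0) ∧
    ∀ Z : Fin S → W, conjEval q (fun s => (Z s : Fin n → ℂ)) ≠ 0 → P Z

end CGeneric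

end

/-!
Write `ev_Z : ℝ[V] → ℂ^S` for the simultaneous evaluation at the samples, a real linear map. Since
`[U | conj U]` is `[Re U | Im U]` times an invertible matrix, the empirical dimension is the real
dimension of `ev_Z(L)` (`rank_fromCols_map_star`), so that `D = D_e + dim (L ∩ ker ev_Z)`
(`empiricalDim_add_finrank_inf_ker`). Everything follows once the generic value of `D_e` is known
to be `min(D, 2S)`: if it is less than `2S`, it equals `D` and the kernel is zero.

The condition `D_e ≥ k` is an open condition given by polynomials in the samples and their
conjugates: if `A [U | conj U] B = 1` at one tuple `Z₀`, with `A`, `B` constant matrices with `k`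
rows and `k` columns respectively, then `q = det (A [U | conj U] B)` is nonzero at `Z₀`, and
`D_e ≥ k` wherever `q ≠ 0`. Hence it suffices to find a single tuple with `D_e ≥ min(D, 2S)`. The
points are chosen one at a time, each lowering the dimension of the common kernel by two, or to
zero if it was at most two (`exists_finrank_inf_ker_evalLinear_le`).

For this step one needs, given two linearly independent functions `g, h ∈ ℝ[V]`, a point `z ∈ W`
at which `g(z)` and `h(z)` are linearly independent over `ℝ`. Otherwise `g / h` is real wherever
it is defined on `W`. For every nonreal `c` the function `h` then vanishes on the zero set of
`g - c h` in `W`, and the Nullstellensatz makes `g - c h` divide a power of `h` in `ℂ[W]`; so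
`1 / (g / h - c)` lies in the localization `ℂ[W]_h`, which has countable dimension over `ℂ`. If
`g / h` were transcendental over `ℂ`, these uncountably many inverses would be linearly
independent. Hence `g / h` is algebraic over `ℂ`, that is, a constant, which has to be real
(`exists_eq_mul_of_im_eq_zero`).
-/

noncomputable section

namespace CGeneric

open MvPolynomial

/-! ### Ratios with uncountably many omitted values -/

/-- If `A` has countable dimension over `F` and `1 / (g / h - c)` lies in the localization `A_h` for
uncountably many `c`, then `g / h` is a constant: otherwise it is transcendental over `F`, and the
`1 / (g / h - c)` are linearly independent in a space of countable dimension. -/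
theorem exists_eq_smul_of_uncountable_dvd_pow {F A : Type} [Field F] [IsAlgClosed F] [CommRing A]
    [IsDomain A] [Algebra F A] {s : Set A} (hs : s.Countable) (hspan : Submodule.span F s = ⊤)
    {g h : A} (hh : h ≠ 0) {T : Set F} (hT : ¬ T.Countable)
    (hdvd : ∀ c ∈ T, ∃ k : ℕ, g - c • h ∣ h ^ k) : ∃ c : F, g = c • h := by
  let K := FractionRing A
  let φ : A →ₐ[F] K := IsScalarTower.toAlgHom F A K
  have hφ : Function.Injective φ := IsFractionRing.injective A K
  have hφh : φ h ≠ 0 := by rwa [Ne, map_eq_zero_iff φ hφ]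
  by_cases hf : IsAlgebraic F (φ g / φ h)
  · obtain ⟨c, hc⟩ : ∃ c : F, algebraMap F K c = φ g / φ h := by
      have := IsAlgClosed.degree_eq_one_of_irreducible F (minpoly.irreducible hf.isIntegral)
      exact minpoly.mem_range_of_degree_eq_one F _ this
    refine ⟨c, hφ ?_⟩
    rw [eq_div_iff hφh] at hc
    rw [map_smul, Algebra.smul_def, hc]
  · exfalso
    have hli := Transcendental.linearIndependent_sub_inv hf
    -- `B` spans the image of the localization `A_h` in the fraction field.
    let B : Set K := Set.range fun x : s × ℕ => φ x.1 * (φ h)⁻¹ ^ x.2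
    have : Countable s := hs
    have hB : B.Countable := Set.countable_range _
    have key : ∀ (k : ℕ) (a : A), φ a * (φ h)⁻¹ ^ k ∈ Submodule.span F B := by
      intro k a
      have ha : a ∈ Submodule.span F s := hspan ▸ Submodule.mem_top
      induction ha using Submodule.span_induction with
      | mem x hx => exact Submodule.subset_span ⟨(⟨x, hx⟩, k), rfl⟩
      | zero => simp
      | add x y _ _ hx hy => rw [map_add, add_mul]; exact add_mem hx hy
      | smul c x _ hx => rw [map_smul, smul_mul_assoc]; exact Submodule.smul_mem _ _ hx
    have hmem : ∀ c : T, (φ g / φ h - algebraMap F K c)⁻¹ ∈ Submodule.span F B := by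
      rintro ⟨c, hc⟩
      obtain ⟨k, a, hk⟩ := hdvd c hc
      have hk' : φ h ^ k = (φ g - algebraMap F K c * φ h) * φ a := by
        rw [← map_pow, hk, map_mul, map_sub, map_smul, Algebra.smul_def]
      have hne : φ g - algebraMap F K c * φ h ≠ 0 := by
        intro h0
        rw [h0, zero_mul] at hk'
        exact pow_ne_zero _ hφh hk'
      convert key k (a * h) using 1
      rw [map_mul, inv_pow, hk', div_sub' hφh]
      have ha : φ a ≠ 0 := by
        intro h0
        rw [h0, mul_zero] at hk'
        exact pow_ne_zero _ hφh hk'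
      rw [mul_comm (φ h), inv_div, mul_inv, div_eq_mul_inv, mul_comm (φ a), mul_mul_mul_comm,
        mul_inv_cancel₀ ha, mul_one]
    have hli' : LinearIndependent F
        (fun c : T => (⟨_, hmem c⟩ : Submodule.span F B)) :=
      LinearIndependent.of_comp (Submodule.span F B).subtype
        (hli.comp (Subtype.val : T → F) Subtype.val_injective)
    exact hT (Cardinal.le_aleph0_iff_set_countable.mp
      (hli'.cardinal_le_rank.trans ((rank_span_le B).trans hB.le_aleph0)))

/-! ### Irreducible varieties and ratios of real polynomials -/

variable {n : ℕ}

theorem IsVariety.inter_zeroLocus_singleton {W : Set (Fin n → ℂ)} (hW : IsVariety W)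
    (p : MvPolynomial (Fin n) ℂ) : IsVariety {z ∈ W | aeval z p = 0} := by
  obtain ⟨I, rfl⟩ := hW
  refine ⟨I ⊔ Ideal.span {p}, ?_⟩
  rw [zeroLocus_vanishingIdeal_galoisConnection.l_sup, zeroLocus_span]
  ext z
  simp only [Set.mem_ofPred_eq, Set.mem_singleton_iff, forall_eq]
  rfl

theorem IsIrreducibleVariety.isPrime_vanishingIdeal {W : Set (Fin n → ℂ)}
    (hW : IsIrreducibleVariety W) :
    (vanishingIdeal ℂ W : Ideal (MvPolynomial (Fin n) ℂ)).IsPrime := by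
  refine ⟨?_, ?_⟩
  · intro h
    obtain ⟨z, hz⟩ := hW.nonempty
    have h1 : (1 : MvPolynomial (Fin n) ℂ) ∈ vanishingIdeal ℂ W := h ▸ Submodule.mem_top
    simpa using h1 z hz
  · intro p r hpr
    have hcover : W = {z ∈ W | aeval z p = 0} ∪ {z ∈ W | aeval z r = 0} := by
      ext z
      constructor
      · intro hz
        have := hpr z hz
        rw [map_mul, mul_eq_zero] at this
        exact this.imp (⟨hz, ·⟩) (⟨hz, ·⟩)
      · rintro (h | h) <;> exact h.1
    refine (hW.eq_or_eq _ _ (hW.isVariety.inter_zeroLocus_singleton p)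
      (hW.isVariety.inter_zeroLocus_singleton r) hcover).imp ?_ ?_ <;>
    · intro h z hz
      rw [h] at hz
      exact hz.2

theorem exists_countable_span_eq_top (J : Ideal (MvPolynomial (Fin n) ℂ)) :
    ∃ s : Set (MvPolynomial (Fin n) ℂ ⧸ J), s.Countable ∧ Submodule.span ℂ s = ⊤ := by
  refine ⟨(Ideal.Quotient.mkₐ ℂ J).toLinearMap '' Set.range (basisMonomials (Fin n) ℂ),
    (Set.countable_range _).image _, ?_⟩
  rw [Submodule.span_image, Module.Basis.span_eq, Submodule.map_top, LinearMap.range_eq_top]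
  exact Ideal.Quotient.mkₐ_surjective ℂ J

/-- A ratio `g / h` of real polynomials that takes only real values on an irreducible variety is a
real constant there. The hypothesis `him` expresses that `g(z) / h(z)` is real where `h(z) ≠ 0`. -/
theorem exists_eq_mul_of_im_eq_zero {W : Set (Fin n → ℂ)} (hW : IsIrreducibleVariety W)
    {g h : MvPolynomial (Fin n) ℝ} (hh : ∃ z ∈ W, aeval z h ≠ 0)
    (him : ∀ z ∈ W, (aeval z g * star (aeval z h)).im = 0) :
    ∃ c : ℝ, ∀ z ∈ W, aeval z g = c * aeval z h := by
  obtain ⟨z₀, hz₀, hne⟩ := hh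
  let J : Ideal (MvPolynomial (Fin n) ℂ) := vanishingIdeal ℂ W
  have : J.IsPrime := hW.isPrime_vanishingIdeal
  let ι : MvPolynomial (Fin n) ℝ →+* MvPolynomial (Fin n) ℂ := map (algebraMap ℝ ℂ)
  have hι : ∀ (z : Fin n → ℂ) (p : MvPolynomial (Fin n) ℝ), aeval z (ι p) = aeval z p :=
    fun z p => aeval_map_algebraMap ℂ z p
  have hmk : ∀ (z : Fin n → ℂ) (c : ℂ),
      aeval z (ι g - c • ι h) = aeval z g - c * aeval z h := by
    intro z c
    rw [map_sub, map_smul, hι, hι, smul_eq_mul]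
  have hreal : ∀ z ∈ W, ∀ c : ℂ, aeval z g = c * aeval z h → aeval z h ≠ 0 → c.im = 0 := by
    intro z hz c hc h0
    have := him z hz
    rw [hc, mul_assoc, Complex.star_def, Complex.mul_conj, Complex.im_mul_ofReal,
      mul_eq_zero, Complex.normSq_eq_zero] at this
    exact this.resolve_right h0
  obtain ⟨s, hs, hspan⟩ := exists_countable_span_eq_top J
  -- Every `c` off the real axis is an omitted value of `g / h`.
  have hT : ¬ {c : ℂ | c.im ≠ 0}.Countable := by
    intro hc
    have hinj : Function.Injective fun r : ℝ => (⟨r, 1⟩ : ℂ) := fun a b h => congrArg Complex.re h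
    have := (hc.preimage_of_injOn (f := fun r : ℝ => (⟨r, 1⟩ : ℂ)) hinj.injOn)
    exact Cardinal.not_countable_real (this.mono fun r _ => by simp)
  obtain ⟨c, hc⟩ := exists_eq_smul_of_uncountable_dvd_pow (F := ℂ) hs hspan
    (g := Ideal.Quotient.mk J (ι g)) (h := Ideal.Quotient.mk J (ι h))
    (by
      rw [Ne, Ideal.Quotient.eq_zero_iff_mem]
      exact fun hmem => hne ((hι z₀ h).symm.trans (hmem z₀ hz₀)))
    hT
    (by
      intro c hc
      obtain ⟨I, hI⟩ := hW.isVariety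
      have hrad : ι h ∈ (J ⊔ Ideal.span {ι g - c • ι h}).radical := by
        rw [← vanishingIdeal_zeroLocus_eq_radical (K := ℂ)]
        intro z hz
        rw [zeroLocus_vanishingIdeal_galoisConnection.l_sup, zeroLocus_span] at hz
        obtain ⟨hzJ, hz⟩ := hz
        have hzW : z ∈ W := by
          rw [hI]
          refine fun p hp => hzJ p ?_
          rw [show J = vanishingIdeal ℂ W from rfl, hI]
          exact le_vanishingIdeal_zeroLocus I hp
        have hz0 := hz _ rfl
        rw [hmk, sub_eq_zero] at hz0
        rw [hι]
        by_contra h0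
        exact hc (hreal z hzW c hz0 h0)
      obtain ⟨k, hk⟩ := hrad
      refine ⟨k, ?_⟩
      obtain ⟨a, ha, b, hb, hab⟩ := Submodule.mem_sup.mp hk
      obtain ⟨d, rfl⟩ := Ideal.mem_span_singleton'.mp hb
      refine ⟨Ideal.Quotient.mk J d, ?_⟩
      rw [← map_pow, ← hab, map_add, Ideal.Quotient.eq_zero_iff_mem.mpr ha, zero_add, map_mul,
        mul_comm]
      rfl)
  have hc' : ∀ z ∈ W, aeval z g = c * aeval z h := by
    have hmem : ι g - c • ι h ∈ J := by
      rw [← Ideal.Quotient.eq_zero_iff_mem, map_sub, hc, sub_eq_zero]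
      rfl
    intro z hz
    have := hmem z hz
    rwa [hmk, sub_eq_zero] at this
  have hcim := hreal z₀ hz₀ c (hc' z₀ hz₀) hne
  refine ⟨c.re, fun z hz => ?_⟩
  rw [hc' z hz]
  congr 1
  exact Complex.ext rfl (by simpa using hcim)

/-! ### Ranks and linear algebra -/

/-- The rank of a family of vectors does not change under extension of the base field. -/
theorem finrank_span_range_algebraMap_comp {K E ι κ : Type*} [Field K] [Field E] [Algebra K E]
    [Finite ι] [Finite κ] (v : ι → κ → K) :
    Module.finrank E (Submodule.span E (Set.range fun i => algebraMap K E ∘ v i)) =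
      Module.finrank K (Submodule.span K (Set.range v)) := by
  obtain ⟨τ, a, ha, hspan, hli⟩ := exists_linearIndependent' K v
  have : Finite τ := Finite.of_injective a ha
  have : Fintype τ := Fintype.ofFinite τ
  have hli' : LinearIndependent E (fun i => algebraMap K E ∘ (v ∘ a) i) :=
    linearIndependent_algebraMap_comp_iff.mpr hli
  have hspan' : Submodule.span E (Set.range fun i => algebraMap K E ∘ v i) =
      Submodule.span E (Set.range fun i => algebraMap K E ∘ (v ∘ a) i) := by
    refine le_antisymm (Submodule.span_le.mpr ?_) (Submodule.span_mono ?_)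
    · rintro _ ⟨i, rfl⟩
      have hi : v i ∈ Submodule.span K (Set.range (v ∘ a)) :=
        hspan ▸ Submodule.subset_span ⟨i, rfl⟩
      have hle : Submodule.span K (Set.range (v ∘ a)) ≤
          ((Submodule.span E (Set.range fun i => algebraMap K E ∘ (v ∘ a) i)).restrictScalars
            K).comap (LinearMap.compLeft (Algebra.linearMap K E) κ) := by
        rw [Submodule.span_le]
        rintro _ ⟨j, rfl⟩
        exact Submodule.subset_span ⟨j, rfl⟩
      exact hle hi
    · rintro _ ⟨j, rfl⟩
      exact ⟨a j, rfl⟩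
  rw [hspan', ← hspan, finrank_span_eq_card hli', finrank_span_eq_card hli]

/-- A matrix of rank at least `k` compresses to the identity of size `k`. Together with
`Matrix.le_rank_of_det_mul_mul_ne_zero` this describes the rank by compressions, without the use
of minors. -/
theorem _root_.Matrix.exists_mul_mul_eq_one_of_le_rank {F m l : Type*} [Field F]
    [Fintype m] [Fintype l] (M : Matrix m l F) {k : ℕ} (hk : k ≤ M.rank) :
    ∃ (A : Matrix (Fin k) m F) (B : Matrix l (Fin k) F), A * M * B = 1 := by
  classical
  obtain ⟨w, hw⟩ := exists_linearIndependent_of_le_finrank hk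
  choose b hb using fun i => (w i).2
  have hli : LinearIndependent F (fun i => (w i : m → F)) :=
    hw.map' _ (Submodule.ker_subtype _)
  let B : Matrix l (Fin k) F := Matrix.of fun j i => b i j
  have hcol : (M * B).col = fun i => (w i : m → F) := by
    ext i j
    rw [← hb i]
    rfl
  have hinj : Function.Injective (M * B).mulVec := by
    rw [Matrix.mulVec_injective_iff, hcol]
    exact hli
  obtain ⟨f, hf⟩ := (M * B).mulVecLin.exists_leftInverse_of_injective
    (LinearMap.ker_eq_bot.mpr hinj)
  refine ⟨LinearMap.toMatrix' f, B, ?_⟩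
  have := congrArg LinearMap.toMatrix' hf
  rwa [LinearMap.toMatrix'_comp, LinearMap.toMatrix'_id, ← Matrix.toLin'_apply',
    LinearMap.toMatrix'_toLin', ← Matrix.mul_assoc] at this

theorem _root_.Matrix.le_rank_of_det_mul_mul_ne_zero {F m l : Type*} [Field F]
    [Fintype m] [Fintype l] (M : Matrix m l F) {k : ℕ} (A : Matrix (Fin k) m F)
    (B : Matrix l (Fin k) F)
    (h : (A * M * B).det ≠ 0) : k ≤ M.rank := by
  calc k = (A * M * B).rank := by
        rw [Matrix.rank_of_det_ne_zero h, Fintype.card_fin]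
    _ ≤ (A * M).rank := Matrix.rank_mul_le_left _ _
    _ ≤ M.rank := Matrix.rank_mul_le_right _ _

theorem finrank_map_add_finrank_inf_ker {K V V' : Type*} [Field K] [AddCommGroup V] [Module K V]
    [AddCommGroup V'] [Module K V'] (f : V →ₗ[K] V') (L : Submodule K V) [FiniteDimensional K L] :
    Module.finrank K (L.map f) + Module.finrank K (L ⊓ LinearMap.ker f : Submodule K V) =
      Module.finrank K L := by
  rw [← (f.domRestrict L).finrank_range_add_finrank_ker, LinearMap.range_domRestrict,
    LinearMap.ker_domRestrict]
  congr 1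
  rw [← Submodule.map_comap_subtype]
  exact LinearEquiv.finrank_eq ((Submodule.equivMapOfInjective _ L.injective_subtype _).symm)

/-- The complex rank of `[U | conj U]` is the real rank of the rows of `U`. -/
theorem rank_fromCols_map_star {N S : ℕ} (U : Matrix (Fin N) (Fin S) ℂ) :
    (Matrix.fromCols U (U.map star)).rank =
      Module.finrank ℝ (Submodule.span ℝ (Set.range U.row)) := by
  -- `[U | conj U] = [Re U | Im U] * P`, with inverse `Q` of `P`.
  let R : Matrix (Fin N) (Fin S ⊕ Fin S) ℝ :=
    Matrix.fromCols (U.map Complex.re) (U.map Complex.im)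
  let P : Matrix (Fin S ⊕ Fin S) (Fin S ⊕ Fin S) ℂ :=
    Matrix.fromBlocks 1 1 (Complex.I • 1) (-(Complex.I • 1))
  let Q : Matrix (Fin S ⊕ Fin S) (Fin S ⊕ Fin S) ℂ :=
    (2 : ℂ)⁻¹ • Matrix.fromBlocks 1 (-(Complex.I • 1)) 1 (Complex.I • 1)
  have hPQ : P * Q = 1 := by
    rw [Matrix.mul_smul, Matrix.fromBlocks_multiply, Matrix.fromBlocks_smul,
      ← Matrix.fromBlocks_one]
    congr 1 <;> ext i j <;> by_cases hij : i = j <;> simp [hij, Matrix.one_apply] <;> norm_num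
  have hP : IsUnit P.det := by
    have := congrArg Matrix.det hPQ
    rw [Matrix.det_mul, Matrix.det_one] at this
    exact IsUnit.of_mul_eq_one _ this
  have hmul : Matrix.fromCols U (U.map star) = R.map (algebraMap ℝ ℂ) * P := by
    have hR : R.map (algebraMap ℝ ℂ) = Matrix.fromCols
        ((U.map Complex.re).map (algebraMap ℝ ℂ)) ((U.map Complex.im).map (algebraMap ℝ ℂ)) := by
      ext i (j | j) <;> rfl
    rw [hR, Matrix.fromCols_mul_fromBlocks]
    congr 1 <;> ext i j <;> simp [Complex.ext_iff]
  rw [hmul, Matrix.rank_mul_eq_left_of_isUnit_det _ _ hP, Matrix.rank_eq_finrank_span_row]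
  refine (finrank_span_range_algebraMap_comp R.row).trans ?_
  let e : (Fin S → ℂ) →ₗ[ℝ] (Fin S ⊕ Fin S → ℝ) :=
    { toFun := fun x => Sum.elim (fun s => (x s).re) (fun s => (x s).im)
      map_add' := fun x y => by ext (s | s) <;> simp
      map_smul' := fun c x => by ext (s | s) <;> simp }
  have he : Function.Injective e := by
    intro x y hxy
    ext s
    exact Complex.ext (congrFun hxy (Sum.inl s)) (congrFun hxy (Sum.inr s))
  have hrow : Set.range R.row = e '' Set.range U.row := by
    rw [← Set.range_comp]
    congr 1
  rw [hrow, Submodule.span_image]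
  exact LinearEquiv.finrank_eq ((Submodule.equivMapOfInjective e he _).symm)

/-! ### Evaluation at points of `W` -/

theorem aeval_star (z : Fin n → ℂ) (p : MvPolynomial (Fin n) ℝ) :
    aeval (star z) p = star (aeval z p) := by
  have : aeval (star z) = (Complex.conjAe : ℂ →ₐ[ℝ] ℂ).comp (aeval z) := by
    ext i
    simp
  rw [this]
  rfl

theorem evalAt_mk (V : Set (Fin n → ℂ)) (z : V) (p : MvPolynomial (Fin n) ℝ) :
    evalAt V z (Ideal.Quotient.mk (vanishingIdeal ℝ V) p) = aeval (z : Fin n → ℂ) p :=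
  rfl

/-- An element of `ℝ[W ∪ conj W]` is determined by its values on `W`, since a real polynomial that
vanishes at `z` vanishes at `conj z`. -/
theorem eq_zero_of_evalAt_eq_zero {W : Set (Fin n → ℂ)} {f : CoordRing (selfConj W)}
    (hf : ∀ z : W, evalAt (selfConj W) (toSelfConj z) f = 0) : f = 0 := by
  obtain ⟨p, rfl⟩ := Ideal.Quotient.mk_surjective f
  rw [Ideal.Quotient.eq_zero_iff_mem]
  rintro z (hz | ⟨w, hw, rfl⟩)
  · exact hf ⟨z, hz⟩
  · rw [aeval_star, show aeval w p = 0 from hf ⟨w, hw⟩, star_zero]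

/-- Evaluation at a point of `W`, as a real linear map on `ℝ[W ∪ conj W]`. -/
def evalLinear {W : Set (Fin n → ℂ)} (z : W) : CoordRing (selfConj W) →ₗ[ℝ] ℂ :=
  (evalAt (selfConj W) (toSelfConj z)).toLinearMap

/-- Simultaneous evaluation at the samples `Z`, as a real linear map. -/
def evalSamples {W : Set (Fin n → ℂ)} {S : ℕ} (Z : Fin S → W) :
    CoordRing (selfConj W) →ₗ[ℝ] (Fin S → ℂ) :=
  LinearMap.pi fun s => evalLinear (Z s)

theorem linearIndependent_of_im_mul_star_ne_zero {w : Fin 2 → ℂ}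
    (hw : (w 0 * star (w 1)).im ≠ 0) : LinearIndependent ℝ w := by
  rw [Fintype.linearIndependent_iff]
  -- Cramer's rule: the imaginary part is the determinant of the two vectors of `ℝ²`, up to sign.
  intro c hc
  rw [Fin.sum_univ_two] at hc
  have hre := congrArg Complex.re hc
  have him := congrArg Complex.im hc
  simp only [Complex.add_re, Complex.add_im, Complex.real_smul, Complex.re_ofReal_mul,
    Complex.im_ofReal_mul, Complex.zero_re, Complex.zero_im] at hre him
  rw [Complex.star_def, Complex.mul_im, Complex.conj_re, Complex.conj_im] at hw
  rw [Fin.forall_fin_two]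
  constructor
  · refine (mul_eq_zero.mp ?_).resolve_right hw
    linear_combination (w 1).re * him - (w 1).im * hre
  · refine (mul_eq_zero.mp ?_).resolve_right hw
    linear_combination (w 0).im * hre - (w 0).re * him

/-- Two independent functions take values at some point of `W` that are independent over `ℝ`; here
the irreducibility of `W` enters. -/
theorem exists_linearIndependent_evalLinear {W : Set (Fin n → ℂ)} (hW : IsIrreducibleVariety W)
    {f : Fin 2 → CoordRing (selfConj W)} (hf : LinearIndependent ℝ f) :
    ∃ z : W, LinearIndependent ℝ fun i => evalLinear z (f i) := by
  by_contra! hcon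
  obtain ⟨g, hg⟩ := Ideal.Quotient.mk_surjective (f 0)
  obtain ⟨h, hh⟩ := Ideal.Quotient.mk_surjective (f 1)
  have hg' (z : W) : evalLinear z (f 0) = aeval (z : Fin n → ℂ) g := by rw [← hg]; rfl
  have hh' (z : W) : evalLinear z (f 1) = aeval (z : Fin n → ℂ) h := by rw [← hh]; rfl
  have hne : ∃ z ∈ W, aeval z h ≠ 0 := by
    by_contra! h0
    exact hf.ne_zero 1 (eq_zero_of_evalAt_eq_zero fun z => (hh' z).trans (h0 z z.2))
  obtain ⟨c, hc⟩ := exists_eq_mul_of_im_eq_zero hW (g := g) hne (by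
    intro z hz
    by_contra him
    refine hcon ⟨z, hz⟩ (linearIndependent_of_im_mul_star_ne_zero ?_)
    rwa [hg', hh'])
  have h0 : f 0 - c • f 1 = 0 := eq_zero_of_evalAt_eq_zero fun z => by
    change evalLinear z (f 0 - c • f 1) = 0
    rw [map_sub, map_smul, hg', hh', hc z z.2, Complex.real_smul, sub_self]
  have := Fintype.linearIndependent_iff.mp hf ![1, -c] (by
    simpa [Fin.sum_univ_two, sub_eq_add_neg] using h0) 0
  simp at this

/-- One more sample can lower the dimension of the kernel by two, or to zero if it is at most two
(the subtraction truncates). -/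
theorem exists_finrank_inf_ker_evalLinear_le {W : Set (Fin n → ℂ)} (hW : IsIrreducibleVariety W)
    (K : Submodule ℝ (CoordRing (selfConj W))) [FiniteDimensional ℝ K] :
    ∃ z : W, Module.finrank ℝ (K ⊓ LinearMap.ker (evalLinear z) :
      Submodule ℝ (CoordRing (selfConj W))) ≤ Module.finrank ℝ K - 2 := by
  suffices ∃ z : W, min (Module.finrank ℝ K) 2 ≤ Module.finrank ℝ (K.map (evalLinear z)) by
    obtain ⟨z, hz⟩ := this
    have := finrank_map_add_finrank_inf_ker (evalLinear z) K
    exact ⟨z, by omega⟩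
  rcases le_or_gt 2 (Module.finrank ℝ K) with h2 | h2
  · obtain ⟨f, hf⟩ := exists_linearIndependent_of_le_finrank h2
    obtain ⟨z, hz⟩ := exists_linearIndependent_evalLinear hW
      (f := fun i => (f i : CoordRing (selfConj W))) (hf.map' _ (Submodule.ker_subtype K))
    refine ⟨z, (min_le_right _ _).trans ?_⟩
    have hli : LinearIndependent ℝ fun i =>
        (⟨_, Submodule.mem_map_of_mem (f i).2⟩ : K.map (evalLinear z)) :=
      LinearIndependent.of_comp (K.map (evalLinear z)).subtype hz
    simpa using hli.fintype_card_le_finrank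
  · obtain h0 | h1 : Module.finrank ℝ K = 0 ∨ Module.finrank ℝ K = 1 := by omega
    · obtain ⟨z, hz⟩ := hW.nonempty
      exact ⟨⟨z, hz⟩, by simp [h0]⟩
    · obtain ⟨f, hfK, hf⟩ := K.exists_mem_ne_zero_of_ne_bot (by
        rintro rfl
        simp at h1)
      obtain ⟨z, hz⟩ : ∃ z : W, evalLinear z f ≠ 0 := by
        by_contra! h0
        exact hf (eq_zero_of_evalAt_eq_zero h0)
      refine ⟨z, (min_le_left _ _).trans (h1.le.trans ?_)⟩
      rw [Submodule.one_le_finrank_iff]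
      intro hbot
      exact hz ((Submodule.mem_bot ℝ).mp (hbot ▸ Submodule.mem_map_of_mem hfK))

/-- Some tuple of `S` samples imposes `min (dim L) (2 * S)` independent real conditions on `L`. -/
theorem exists_finrank_inf_ker_evalSamples_le {W : Set (Fin n → ℂ)}
    (hW : IsIrreducibleVariety W) (L : Submodule ℝ (CoordRing (selfConj W)))
    [FiniteDimensional ℝ L] (S : ℕ) :
    ∃ Z : Fin S → W, Module.finrank ℝ (L ⊓ LinearMap.ker (evalSamples Z) :
      Submodule ℝ (CoordRing (selfConj W))) ≤ Module.finrank ℝ L - 2 * S := by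
  induction S with
  | zero => exact ⟨Fin.elim0, by simpa using Submodule.finrank_mono (inf_le_left)⟩
  | succ S ih =>
    obtain ⟨Z, hZ⟩ := ih
    have : FiniteDimensional ℝ (L ⊓ LinearMap.ker (evalSamples Z) :
        Submodule ℝ (CoordRing (selfConj W))) := Submodule.finiteDimensional_inf_left _ _
    obtain ⟨z, hz⟩ := exists_finrank_inf_ker_evalLinear_le hW (L ⊓ LinearMap.ker (evalSamples Z))
    refine ⟨Fin.cons z Z, ?_⟩
    have hker : L ⊓ LinearMap.ker (evalSamples (Fin.cons z Z : Fin (S + 1) → W)) =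
        L ⊓ LinearMap.ker (evalSamples Z) ⊓ LinearMap.ker (evalLinear z) := by
      ext f
      simp only [Submodule.mem_inf, LinearMap.mem_ker, evalSamples, funext_iff,
        LinearMap.pi_apply, Fin.forall_fin_succ, Fin.cons_zero, Fin.cons_succ, Pi.zero_apply]
      tauto
    rw [hker]
    omega

/-- The empirical dimension is the codimension in `L` of the subspace of functions that vanish at
all samples; in particular it does not depend on the generating vector `v`. -/
theorem empiricalDim_add_finrank_inf_ker {W : Set (Fin n → ℂ)}
    (L : Submodule ℝ (CoordRing (selfConj W))) [FiniteDimensional ℝ L] {S N : ℕ}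
    {v : Fin N → CoordRing (selfConj W)} (hv : Submodule.span ℝ (Set.range v) = L)
    (Z : Fin S → W) :
    empiricalDim v (fun s => toSelfConj (Z s)) +
      Module.finrank ℝ (L ⊓ LinearMap.ker (evalSamples Z) :
        Submodule ℝ (CoordRing (selfConj W))) = Module.finrank ℝ L := by
  have hspan : Submodule.span ℝ (Set.range (evalMatrix v fun s => toSelfConj (Z s)).row) =
      L.map (evalSamples Z) := by
    rw [← hv, Submodule.map_span, ← Set.range_comp]
    rfl
  rw [← finrank_map_add_finrank_inf_ker (evalSamples Z) L, empiricalDim, rank_fromCols_map_star,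
    hspan]

/-! ### The matrix `[U | conj U]` as a polynomial matrix -/

/-- The matrix `[U | conj U]` of the functions represented by the real polynomials `p`, with
polynomial entries in the coordinates of the samples and of their conjugates. -/
def polyEvalMatrix {D : ℕ} (p : Fin D → MvPolynomial (Fin n) ℝ) (S : ℕ) :
    Matrix (Fin D) (Fin S ⊕ Fin S) (MvPolynomial ((Fin S × Fin n) ⊕ (Fin S × Fin n)) ℂ) :=
  Matrix.fromCols
    (Matrix.of fun i s => rename (fun j => Sum.inl (s, j)) (map (algebraMap ℝ ℂ) (p i)))
    (Matrix.of fun i s => rename (fun j => Sum.inr (s, j)) (map (algebraMap ℝ ℂ) (p i)))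

/-- The determinant of the compression `A [U | conj U] B` by constant matrices `A` and `B`, as a
polynomial in the coordinates of the samples and of their conjugates. Every minor of
`[U | conj U]` is of this form. -/
def compressionDet {D S k : ℕ} (p : Fin D → MvPolynomial (Fin n) ℝ) (A : Matrix (Fin k) (Fin D) ℂ)
    (B : Matrix (Fin S ⊕ Fin S) (Fin k) ℂ) :
    MvPolynomial ((Fin S × Fin n) ⊕ (Fin S × Fin n)) ℂ :=
  Matrix.det (A.map (C (σ := (Fin S × Fin n) ⊕ (Fin S × Fin n))) * polyEvalMatrix p S *
    B.map (C (σ := (Fin S × Fin n) ⊕ (Fin S × Fin n))))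

theorem conjEval_compressionDet {W : Set (Fin n → ℂ)} {D S k : ℕ}
    (p : Fin D → MvPolynomial (Fin n) ℝ) (A : Matrix (Fin k) (Fin D) ℂ)
    (B : Matrix (Fin S ⊕ Fin S) (Fin k) ℂ) (Z : Fin S → W) :
    conjEval (compressionDet p A B) (fun s => (Z s : Fin n → ℂ)) =
      (A * Matrix.fromCols
        (evalMatrix (fun i => Ideal.Quotient.mk (vanishingIdeal ℝ (selfConj W)) (p i))
          fun s => toSelfConj (Z s))
        ((evalMatrix (fun i => Ideal.Quotient.mk (vanishingIdeal ℝ (selfConj W)) (p i))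
          fun s => toSelfConj (Z s)).map star) * B).det := by
  rw [conjEval, compressionDet, RingHom.map_det, RingHom.mapMatrix_apply, Matrix.map_mul,
    Matrix.map_mul]
  have hC : ∀ {a b : Type} (M : Matrix a b ℂ) (x : (Fin S × Fin n) ⊕ (Fin S × Fin n) → ℂ),
      (M.map C).map (eval x) = M := by
    intro a b M x
    ext i j
    simp
  rw [hC, hC]
  congr 3
  ext i (s | s)
  · simp only [polyEvalMatrix, Matrix.map_apply, Matrix.fromCols_apply_inl, Matrix.of_apply,
      eval_rename, evalMatrix, evalAt_mk, eval_map]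
    rfl
  · simp only [polyEvalMatrix, Matrix.map_apply, Matrix.fromCols_apply_inr, Matrix.of_apply,
      eval_rename, evalMatrix, evalAt_mk, eval_map, ← aeval_star]
    rfl

end CGeneric

end

theorem mainTheorem2 (n : ℕ) (W : Set (Fin n → ℂ)) (hW : CGeneric.IsIrreducibleVariety W)
    (L : Submodule ℝ (CGeneric.CoordRing (CGeneric.selfConj W))) (hL : FiniteDimensional ℝ L)
    (S : ℕ) :
    CGeneric.HoldsCGenerically W S fun Z =>
      ∀ (N : ℕ) (v : Fin N → CGeneric.CoordRing (CGeneric.selfConj W)),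
        Submodule.span ℝ (Set.range v) = L →
        CGeneric.empiricalDim v (fun s => CGeneric.toSelfConj (Z s)) < 2 * S →
          CGeneric.Poised L (fun s => CGeneric.toSelfConj (Z s)) ∧
          Module.finrank ℝ L = CGeneric.empiricalDim v (fun s => CGeneric.toSelfConj (Z s)) := by
  obtain ⟨Z₀, hZ₀⟩ := CGeneric.exists_finrank_inf_ker_evalSamples_le hW L S
  let b := Module.finBasis ℝ L
  choose p hp using fun i =>
    Ideal.Quotient.mk_surjective (b i : CGeneric.CoordRing (CGeneric.selfConj W))
  let u : Fin (Module.finrank ℝ L) → CGeneric.CoordRing (CGeneric.selfConj W) :=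
    fun i => Ideal.Quotient.mk _ (p i)
  have hu : Submodule.span ℝ (Set.range u) = L := by
    have : u = L.subtype ∘ b := funext hp
    rw [this, Set.range_comp, Submodule.span_image, b.span_eq, Submodule.map_top,
      Submodule.range_subtype]
  have hu₀ := CGeneric.empiricalDim_add_finrank_inf_ker L hu Z₀
  -- `A` and `B` certify the maximal rank at `Z₀`; the same `A` and `B` are used at every `Z`.
  obtain ⟨A, B, hAB⟩ := Matrix.exists_mul_mul_eq_one_of_le_rank _
    (show min (Module.finrank ℝ L) (2 * S) ≤
      CGeneric.empiricalDim u (fun s => CGeneric.toSelfConj (Z₀ s)) by omega)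
  refine ⟨CGeneric.compressionDet p A B, ⟨Z₀, ?_⟩, ?_⟩
  · rw [CGeneric.conjEval_compressionDet]
    exact (congrArg Matrix.det hAB).trans_ne (by simp)
  · intro Z hZ N v hv hlt
    rw [CGeneric.conjEval_compressionDet] at hZ
    have hle : min (Module.finrank ℝ L) (2 * S) ≤
        CGeneric.empiricalDim u (fun s => CGeneric.toSelfConj (Z s)) :=
      Matrix.le_rank_of_det_mul_mul_ne_zero _ A B hZ
    have hdu := CGeneric.empiricalDim_add_finrank_inf_ker L hu Z
    have hdv := CGeneric.empiricalDim_add_finrank_inf_ker L hv Z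
    have : FiniteDimensional ℝ (L ⊓ LinearMap.ker (CGeneric.evalSamples Z) :
        Submodule ℝ (CGeneric.CoordRing (CGeneric.selfConj W))) :=
      Submodule.finiteDimensional_inf_left _ _
    have hker : L ⊓ LinearMap.ker (CGeneric.evalSamples Z) = ⊥ :=
      Submodule.finrank_eq_zero.mp (by omega)
    refine ⟨fun f hfL hf => ?_, by omega⟩
    have hmem : f ∈ L ⊓ LinearMap.ker (CGeneric.evalSamples Z) := ⟨hfL, funext hf⟩
    rwa [hker, Submodule.mem_bot] at hmem
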